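/- **Setting.** Let $\mathcal X$ be a measurable space, $P_{\rm p},P_{\rm n}$ probability distributions on $\mathcal X$ (the class-conditional distributions), $\pi_1,\dots,\pi_m\in[0,1]$ with $\pi_j\neq\pi_{j'}$ for at least one pair $j\ne j'$, $\rho_1,\dots,\rho_m>0$ with $\sum_{j=1}^m\rho_j=1$, and $\pi_{\mathcal D}\in(0,1)$. Let $\bar{\mathcal D}$ be the joint distribution of $(x,\bar y)\in\mathcal X\times\{1,\dots,m\}$ under which $\bar y=j$ with probability $\rho_j$ and, given $\bar y=j$, $x$ has distribution $\pi_jP_{\rm p}+(1-\pi_j)P_{\rm n}$; let $p_{\rm tr}$ be its marginal on $\mathcal X$. For $t\in[0,1]$ put $T(t)=(T_1(t),\dots,T_m(t))$ with $$T_j(t)=\frac{a_jt+b_j}{ct+d},\quad a_j=\rho_j(\pi_j-\pi_{\mathcal D}),\quad b_j=\rho_j\pi_{\mathcal D}(1-\pi_j),\quad c=\sum_{j=1}^m a_j,\quad d=\sum_{j=1}^m b_j,$$ and let $$\alpha=\min\Big(\sum_{j=1}^m\rho_j\pi_j(1-\pi_{\mathcal D}),\ \sum_{j=1}^m\rho_j\pi_{\mathcal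 D}(1-\pi_j)\Big).$$ Let $\mathcal F$ be a class of measurable functions $f:\mathcal X\to[0,1]$ and let $\ell:\mathbb R^m\times\{1,\dots,m\}\to\mathbb R_+$ be a loss. Assume that $\ell(T(f(x)),\bar y)\le M_\ell$ for all $f\in\mathcal F$, $x\in\mathcal X$ and $\bar y$, and that for each $\bar y$ the function $u\mapsto\ell(u,\bar y)$ is $L_\ell$-Lipschitz for the Euclidean norm on the set $\{T(f(x)): f\in\mathcal F,\ x\in\mathcal X\}$. Let $n_{\rm tr}\ge1$, let $(x_1,\bar y_1),\dots,(x_{n_{\rm tr}},\bar y_{n_{\rm tr}})$ be i.i.d. from $\bar{\mathcal D}$, and define $$R_{\rm surr}(f)=\mathbb E_{(x,\bar y)\sim\bar{\mathcal D}}[\ell(T(f(x)),\bar y)],\qquad \widehat R_{\rm surr}(f)=\frac1{n_{\rm tr}}\sum_{i=1}^{n_{\rm tr}}\ell(T(f(x_i)),\bar y_i),$$ $$\mathfrak R_{n_{\rm tr}}(\mathcal F)=\mathbb E\Big[\sup_{f\in\mathcal F}\frac1{n_{\rm tr}}\sum_{i=1}^{n_{\rm tr}}\sigma_if(x_i)\Big],$$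 where $x_1,\dots,x_{n_{\rm tr}}$ are i.i.d. from $p_{\rm tr}$ and $\sigma_1,\dots,\sigma_{n_{\rm tr}}$ are independent uniform signs in $\{-1,1\}$, independent of the $x_i$ (the supremum is assumed to be measurable in $(x_1,\dots,x_{n_{\rm tr}})$, up to null sets, for each choice of the signs, so that the expectation makes sense). **Theorem (estimation error bound).** Let $f^\star_{\rm surr}\in\mathcal F$ minimize $R_{\rm surr}$ over $\mathcal F$. Then for every $\delta>0$ (the claim is void for $\delta\ge1$), with probability at least $1-\delta$ over the sample, every minimizer $\hat f_{\rm surr}$ of $\widehat R_{\rm surr}$ over $\mathcal F$ satisfies $$R_{\rm surr}(\hat f_{\rm surr})-R_{\rm surr}(f^\star_{\rm surr})\le\frac{8\sqrt2\,m\,L_\ell}{\alpha^2}\,\mathfrak R_{n_{\rm tr}}(\mathcal F)+2M_\ell\sqrt{\frac{\ln(2/\delta)}{2n_{\rm tr}}}.$$ -/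

import Mathlib

open MeasureTheory
open scoped NNReal ENNReal

namespace UmSSC

noncomputable section

/-- The law of one point of the `j`-th unlabeled set: the mixture `π j · Pp + (1 - π j) · Pn` of the
positive and the negative class-conditional distributions. -/
def setLaw {X : Type*} [MeasurableSpace X] {m : ℕ} (Pp Pn : Measure X) (π : Fin m → ℝ)
    (j : Fin m) : Measure X :=
  ENNReal.ofReal (π j) • Pp + ENNReal.ofReal (1 - π j) • Pn

/-- The joint law of (point, index of its set): the index is `j` with probability `ρ j`, and given
the index `j` the point has law `setLaw Pp Pn π j`. -/
def surrogateLaw {X : Type*} [MeasurableSpace X] {m : ℕ} (Pp Pn : Measure X) (π ρ : Fin m → ℝ) :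
    Measure (X × Fin m) :=
  ∑ j, ENNReal.ofReal (ρ j) • (setLaw Pp Pn π j).map (fun x => (x, j))

/-- The numerator coefficient `a j = ρ j (π j - π_D)`. -/
def coefA {m : ℕ} (π ρ : Fin m → ℝ) (πD : ℝ) (j : Fin m) : ℝ := ρ j * (π j - πD)

/-- The numerator coefficient `b j = ρ j π_D (1 - π j)`. -/
def coefB {m : ℕ} (π ρ : Fin m → ℝ) (πD : ℝ) (j : Fin m) : ℝ := ρ j * πD * (1 - π j)

/-- The denominator coefficient `c = ∑ j, ρ j (π j - π_D)`. -/
def coefC {m : ℕ} (π ρ : Fin m → ℝ) (πD : ℝ) : ℝ := ∑ j, ρ j * (π j - πD)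

/-- The denominator coefficient `d = ∑ j, ρ j π_D (1 - π j)`. -/
def coefD {m : ℕ} (π ρ : Fin m → ℝ) (πD : ℝ) : ℝ := ∑ j, ρ j * πD * (1 - π j)

/-- The transition function `T t = ((a j t + b j) / (c t + d))_j`, with values in Euclidean space. -/
def transition {m : ℕ} (π ρ : Fin m → ℝ) (πD t : ℝ) : EuclideanSpace ℝ (Fin m) :=
  WithLp.toLp 2 fun j =>
    (coefA π ρ πD j * t + coefB π ρ πD j) / (coefC π ρ πD * t + coefD π ρ πD)

/-- `α = min (∑ j, ρ j π j (1 - π_D)) (∑ j, ρ j π_D (1 - π j))`. -/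
def alpha {m : ℕ} (π ρ : Fin m → ℝ) (πD : ℝ) : ℝ :=
  min (∑ j, ρ j * π j * (1 - πD)) (∑ j, ρ j * πD * (1 - π j))

/-- The surrogate risk `R_surr f = E [ℓ (T (f x), y)]`. -/
def surrRisk {X : Type*} [MeasurableSpace X] {m : ℕ} (Pp Pn : Measure X) (π ρ : Fin m → ℝ)
    (πD : ℝ) (loss : EuclideanSpace ℝ (Fin m) → Fin m → ℝ) (f : X → ℝ) : ℝ :=
  ∫ z, loss (transition π ρ πD (f z.1)) z.2 ∂(surrogateLaw Pp Pn π ρ)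

/-- The empirical surrogate risk of `f` on the sample `S`. -/
def empRisk {X : Type*} {m n : ℕ} (π ρ : Fin m → ℝ) (πD : ℝ)
    (loss : EuclideanSpace ℝ (Fin m) → Fin m → ℝ) (S : Fin n → X × Fin m) (f : X → ℝ) : ℝ :=
  (1 / (n : ℝ)) * ∑ i, loss (transition π ρ πD (f (S i).1)) (S i).2

/-- `sup_{f ∈ F} (1/n) ∑ i, σ i f (x i)` for a vector of signs `σ` (the units of `ℤ` are `1`, `-1`). -/
def signedSup {X : Type*} {n : ℕ} (F : Set (X → ℝ)) (σ : Fin n → ℤˣ) (x : Fin n → X) : ℝ :=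
  ⨆ f : F, (1 / (n : ℝ)) * ∑ i, ((σ i : ℤ) : ℝ) * (f : X → ℝ) (x i)

/-- The Rademacher complexity `E [sup_{f ∈ F} (1/n) ∑ i, σ i f (x i)]`, with `x 1, …, x n` i.i.d. of
law `μ` and with independent uniform signs `σ 1, …, σ n`, that is, `σ` uniform on the `2 ^ n` sign
vectors, independent of `x`. -/
def rademacherComplexity {X : Type*} [MeasurableSpace X] (μ : Measure X) (n : ℕ)
    (F : Set (X → ℝ)) : ℝ :=
  ∫ x, (1 / (2 : ℝ) ^ n) * ∑ σ : Fin n → ℤˣ, signedSup F σ x ∂(Measure.pi fun _ : Fin n => μ)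

end

end UmSSC

namespace UmSSC

/-! Because `fhat` minimizes the empirical risk, its excess risk is at most the one-sided deviation
(R - R̂)(fhat) - (R - R̂)(fstar). The supremum of this quantity over the class moves by at most 2M/n
when one sample point changes, so McDiarmid's inequality controls it around its mean. The reference
term has mean zero, so symmetrization bounds the mean by twice a Rademacher average of the losses.
For a fixed label, t ↦ ℓ(T(t), y) is a scalar function with Lipschitz constant K = m L / α²
(`dist_transition_le`), so the scalar `contraction` principle leaves 2 K times the Rademacher
complexity of the class.

The class may be uncountable, and only the signed suprema of the f themselves are assumed a.e.
measurable, so the supremum of the deviations is replaced by a measurable majorant of least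
integral. It keeps bounded differences up to null sets, which is enough for McDiarmid
(`measure_add_le_of_bounded_differences`), and any other integrable measurable majorant bounds its
mean. `exists_signed_majorant` produces such a competitor by rounding the values of f to a 1/N grid,
whose mesh then tends to 0. -/

/-! ### Contraction -/

/-- The contraction step for a single sign. -/
theorem sup'_add_sup'_neg_le {ι : Type*} [Fintype ι] [Nonempty ι] (A a b : ι → ℝ)
    (hab : ∀ w w', |a w - a w'| ≤ |b w - b w'|) :
    (Finset.univ.sup' Finset.univ_nonempty fun w => A w + a w) +
        (Finset.univ.sup' Finset.univ_nonempty fun w => A w - a w) ≤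
      (Finset.univ.sup' Finset.univ_nonempty fun w => A w + b w) +
        (Finset.univ.sup' Finset.univ_nonempty fun w => A w - b w) := by
  obtain ⟨w₁, -, h₁⟩ := Finset.exists_mem_eq_sup' Finset.univ_nonempty fun w => A w + a w
  obtain ⟨w₂, -, h₂⟩ := Finset.exists_mem_eq_sup' Finset.univ_nonempty fun w => A w - a w
  rw [h₁, h₂]
  have hp := fun w => Finset.le_sup' (fun w => A w + b w) (Finset.mem_univ w)
  have hm := fun w => Finset.le_sup' (fun w => A w - b w) (Finset.mem_univ w)
  have h := (le_abs_self _).trans (hab w₁ w₂)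
  -- The order of `b w₁` and `b w₂` decides which maximizer is tested against `+b` and which against
  -- `-b`.
  rcases abs_cases (b w₁ - b w₂) with ⟨h', -⟩ | ⟨h', -⟩
  · have := hp w₁; have := hm w₂; linarith
  · have := hp w₂; have := hm w₁; linarith

theorem sum_signs_succ {n : ℕ} (g : (Fin (n + 1) → ℤˣ) → ℝ) :
    ∑ σ, g σ = ∑ σ : Fin n → ℤˣ, (g (Fin.cons 1 σ) + g (Fin.cons (-1) σ)) := by
  rw [← (Fin.consEquiv fun _ => ℤˣ).sum_comp, Fintype.sum_prod_type, Finset.sum_comm]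
  refine Finset.sum_congr rfl fun σ _ => ?_
  have : (Finset.univ : Finset ℤˣ) = {1, -1} := by decide
  rw [this, Finset.sum_pair (by decide)]
  rfl

/-- The Ledoux–Talagrand contraction principle, for a finite index set and with an offset `A`. -/
theorem contraction {ι : Type*} [Fintype ι] [Nonempty ι] {n : ℕ} (A : ι → ℝ)
    (a b : Fin n → ι → ℝ) (hab : ∀ i w w', |a i w - a i w'| ≤ |b i w - b i w'|) :
    ∑ σ : Fin n → ℤˣ, (Finset.univ.sup' Finset.univ_nonempty
        fun w => A w + ∑ i, ((σ i : ℤ) : ℝ) * a i w) ≤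
      ∑ σ : Fin n → ℤˣ, (Finset.univ.sup' Finset.univ_nonempty
        fun w => A w + ∑ i, ((σ i : ℤ) : ℝ) * b i w) := by
  induction n generalizing A with
  | zero => simp
  | succ n ih =>
    rw [sum_signs_succ, sum_signs_succ]
    simp only [Fin.sum_univ_succ, Fin.cons_zero, Fin.cons_succ, Units.val_one, Units.val_neg,
      Int.cast_neg, Int.cast_one, one_mul, neg_mul]
    -- With the first sign frozen, its term joins the offset and induction replaces the other `a i`
    -- by `b i`. These then serve as the offset when the first coordinate is replaced.
    have h1 := ih (fun w => A w + a 0 w) (fun i => a i.succ) (fun i => b i.succ)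
      fun i => hab i.succ
    have h2 := ih (fun w => A w + -a 0 w) (fun i => a i.succ) (fun i => b i.succ)
      fun i => hab i.succ
    simp only [add_assoc] at h1 h2
    rw [Finset.sum_add_distrib]
    refine (add_le_add h1 h2).trans ?_
    rw [← Finset.sum_add_distrib]
    refine Finset.sum_le_sum fun σ _ => ?_
    have h := sup'_add_sup'_neg_le (fun w => A w + ∑ i, ((σ i : ℤ) : ℝ) * b i.succ w)
      (a 0) (b 0) (hab 0)
    simpa only [add_assoc, sub_eq_add_neg, add_comm (∑ i, ((σ i : ℤ) : ℝ) * b i.succ _)] using h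

/-! ### Measurable majorants and the bounded differences inequality -/

theorem integrable_of_abs_le {Ω : Type*} [MeasurableSpace Ω] {μ : Measure Ω} [IsFiniteMeasure μ]
    {f : Ω → ℝ} (hf : Measurable f) {B : ℝ} (hB : ∀ x, |f x| ≤ B) : Integrable f μ :=
  Integrable.of_bound hf.aestronglyMeasurable B (ae_of_all _ hB)

/-- A bounded function, measurable or not, has a measurable majorant of least integral. -/
theorem exists_minimal_majorant {Ω : Type*} [MeasurableSpace Ω] (μ : Measure Ω)
    [IsFiniteMeasure μ] (Φ : Ω → ℝ) (B : ℝ) (hB : ∀ x, |Φ x| ≤ B) :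
    ∃ Ψ : Ω → ℝ, Measurable Ψ ∧ (∀ x, |Ψ x| ≤ B) ∧ (∀ x, Φ x ≤ Ψ x) ∧
      ∀ C : Ω → ℝ, Measurable C → Integrable C μ → (∀ x, Φ x ≤ C x) → ∫ x, Ψ x ∂μ ≤ ∫ x, C x ∂μ := by
  -- The `lintegral` of a nonmeasurable function is a lower integral, attained by some measurable
  -- `g` below `B - Φ`; the majorant is `B - g`.
  obtain ⟨g, hgm, hgf, hg⟩ := exists_measurable_le_lintegral_eq μ fun x => ENNReal.ofReal (B - Φ x)
  have hΦ := fun x => abs_le.mp (hB x)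
  have hg1 : ∀ x, (g x).toReal ≤ B - Φ x := fun x =>
    ENNReal.toReal_le_of_le_ofReal (by linarith [hΦ x]) (hgf x)
  have hg0 : ∀ x, 0 ≤ (g x).toReal := fun x => ENNReal.toReal_nonneg
  have hgt : ∀ x, g x ≠ ∞ := fun x => ne_top_of_le_ne_top ENNReal.ofReal_ne_top (hgf x)
  have hgB : ∀ x, |(g x).toReal| ≤ 2 * B := fun x => by
    rw [abs_of_nonneg (hg0 x)]; linarith [hg1 x, hΦ x]
  have hgi : Integrable (fun x => (g x).toReal) μ := integrable_of_abs_le hgm.ennreal_toReal hgB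
  refine ⟨fun x => B - (g x).toReal, measurable_const.sub hgm.ennreal_toReal, fun x => ?_,
    fun x => by linarith [hg1 x], fun C hC hCi hΦC => ?_⟩
  · rw [abs_le]; constructor <;> linarith [hg1 x, hg0 x, hΦ x]
  · have h1 : ∫⁻ x, ENNReal.ofReal (B - C x) ∂μ ≤ ∫⁻ x, g x ∂μ := by
      rw [← hg]
      exact lintegral_mono fun x => ENNReal.ofReal_le_ofReal (by linarith [hΦC x])
    have h2 : ∫ x, (B - C x) ∂μ ≤ ∫ x, (g x).toReal ∂μ := by
      have hi : Integrable (fun x => B - C x) μ := (integrable_const B).sub hCi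
      -- `C` may exceed `B`, and `ENNReal.ofReal` only sees the positive part of `B - C`.
      have hip : Integrable (fun x => max (B - C x) 0) μ := hi.pos_part
      calc ∫ x, (B - C x) ∂μ ≤ ∫ x, max (B - C x) 0 ∂μ :=
            integral_mono hi hip fun x => le_max_left _ _
        _ = (∫⁻ x, ENNReal.ofReal (B - C x) ∂μ).toReal := by
            rw [integral_eq_lintegral_of_nonneg_ae (f := fun x => max (B - C x) 0)
              (ae_of_all _ fun x => le_max_right _ _)
              hip.aestronglyMeasurable]
            congr 1
            refine lintegral_congr fun x => ?_
            rw [ENNReal.ofReal_max]; simp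
        _ ≤ (∫⁻ x, g x ∂μ).toReal := by
            refine ENNReal.toReal_mono ?_ h1
            have := hgi.lintegral_lt_top
            simp only [ENNReal.ofReal_toReal (hgt _)] at this
            exact this.ne
        _ = ∫ x, (g x).toReal ∂μ :=
            (integral_toReal hgm.aemeasurable (ae_of_all _ fun x => (hgt x).lt_top)).symm
    rw [integral_sub (integrable_const B) hCi] at h2
    rw [integral_sub (integrable_const B) hgi]
    linarith

/-- The minimal measurable majorant of a function with bounded differences has bounded differences,
up to null sets. -/
theorem exists_majorant_bounded_differences {Z : Type*} [MeasurableSpace Z] (μ : Measure Z)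
    [IsProbabilityMeasure μ] {n : ℕ} (Φ : (Fin n → Z) → ℝ) (B c : ℝ) (hB : ∀ S, |Φ S| ≤ B)
    (hc : ∀ S i z, Φ S ≤ Φ (Function.update S i z) + c) :
    ∃ Ψ : (Fin n → Z) → ℝ, Measurable Ψ ∧ (∀ S, |Ψ S| ≤ B) ∧ (∀ S, Φ S ≤ Ψ S) ∧
      (∀ C : (Fin n → Z) → ℝ, Measurable C → Integrable C (Measure.pi fun _ => μ) →
        (∀ S, Φ S ≤ C S) →
        ∫ S, Ψ S ∂(Measure.pi fun _ => μ) ≤ ∫ S, C S ∂(Measure.pi fun _ => μ)) ∧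
      ∀ i z, ∀ᵐ S ∂(Measure.pi fun _ => μ), Ψ S ≤ Ψ (Function.update S i z) + c := by
  obtain ⟨Ψ, hm, hΨB, hΦ, hmin⟩ := exists_minimal_majorant (Measure.pi fun _ : Fin n => μ) Φ B hB
  refine ⟨Ψ, hm, hΨB, hΦ, hmin, fun i z => ?_⟩
  have hup : Measurable fun S : Fin n → Z => Function.update S i z := measurable_update_left
  have hΨi : Integrable Ψ (Measure.pi fun _ : Fin n => μ) := integrable_of_abs_le hm hΨB
  -- Bounded differences of `Φ` make this minimum another majorant of `Φ`; since `Ψ` has least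
  -- integral, the two agree almost everywhere.
  have hmi : Measurable fun S => min (Ψ S) (Ψ (Function.update S i z) + c) :=
    hm.min ((hm.comp hup).add_const c)
  have hi : Integrable (fun S => min (Ψ S) (Ψ (Function.update S i z) + c))
      (Measure.pi fun _ : Fin n => μ) :=
    hΨi.inf ((integrable_of_abs_le (hm.comp hup) fun S => hΨB _).add (integrable_const c))
  have h1 := hmin _ hmi hi fun S => le_min (hΦ S) ((hc S i z).trans (by gcongr; exact hΦ _))
  have h2 := integral_mono hi hΨi fun S => min_le_left _ _
  have h3 := (integral_eq_iff_of_ae_le hi hΨi (ae_of_all _ fun S => min_le_left _ _)).mp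
    (le_antisymm h2 h1)
  filter_upwards [h3] with S hS
  rw [← hS]
  exact min_le_right _ _

/-- Hoeffding's lemma, for a bounded function whose values at almost all pairs of points differ by at
most `c`. -/
theorem integral_exp_le_of_ae_pairs {Z : Type*} [MeasurableSpace Z] (μ : Measure Z)
    [IsProbabilityMeasure μ] (f : Z → ℝ) (hf : Measurable f) (B c : ℝ) (hB : ∀ z, |f z| ≤ B)
    (hc : ∀ᵐ w ∂μ, ∀ᵐ z ∂μ, f w ≤ f z + c) (t : ℝ) :
    ∫ z, Real.exp (t * (f z - ∫ z, f z ∂μ)) ∂μ ≤ Real.exp (t ^ 2 * c ^ 2 / 8) := by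
  have hbb : Filter.IsBoundedUnder (· ≥ ·) (ae μ) f :=
    Filter.isBoundedUnder_of ⟨-B, fun z => (abs_le.mp (hB z)).1⟩
  have hcb : Filter.IsCoboundedUnder (· ≥ ·) (ae μ) f :=
    Filter.IsBoundedUnder.isCoboundedUnder_ge
      (Filter.isBoundedUnder_of ⟨B, fun z => (abs_le.mp (hB z)).2⟩)
  have h1 : ∀ᵐ z ∂μ, f z ∈ Set.Icc (essInf f μ) (essInf f μ + c) := by
    filter_upwards [ae_essInf_le hbb, hc] with w hw hcw
    refine ⟨hw, ?_⟩
    have : f w - c ≤ essInf f μ := by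
      refine le_essInf_of_ae_le (hf := ?_) _
      filter_upwards [hcw] with z hz
      linarith
    linarith
  have h2 := (ProbabilityTheory.hasSubgaussianMGF_of_mem_Icc hf.aemeasurable h1).mgf_le t
  simp only [ProbabilityTheory.mgf] at h2
  refine h2.trans (Real.exp_le_exp.mpr (le_of_eq ?_))
  simp only [add_sub_cancel_left, NNReal.coe_pow, NNReal.coe_div, coe_nnnorm, Real.norm_eq_abs,
    NNReal.coe_ofNat, div_pow, sq_abs]
  ring

/-- The exponential moment bound behind McDiarmid's inequality, for differences that are bounded up
to null sets. -/
theorem integral_exp_le_of_bounded_differences {Z : Type*} [MeasurableSpace Z] (μ : Measure Z)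
    [IsProbabilityMeasure μ] {n : ℕ} (Ψ : (Fin n → Z) → ℝ) (hm : Measurable Ψ) (B c : ℝ)
    (hB : ∀ S, |Ψ S| ≤ B)
    (hc : ∀ i z, ∀ᵐ S ∂(Measure.pi fun _ => μ), Ψ S ≤ Ψ (Function.update S i z) + c) (t : ℝ) :
    ∫ S, Real.exp (t * (Ψ S - ∫ S, Ψ S ∂(Measure.pi fun _ => μ))) ∂(Measure.pi fun _ => μ) ≤
      Real.exp (n * (t ^ 2 * c ^ 2 / 8)) := by
  induction n with
  | zero => simp [Subsingleton.elim _ (default : Fin 0 → Z)]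
  | succ n ih =>
    set ν : Measure (Fin n → Z) := Measure.pi fun _ => μ with hν
    have he := measurePreserving_piFinSuccAbove (fun _ : Fin (n + 1) => μ) 0
    have hcoe : ⇑(MeasurableEquiv.piFinSuccAbove (fun _ : Fin (n + 1) => Z) 0).symm =
        fun p : Z × (Fin n → Z) => (Fin.cons p.1 p.2 : Fin (n + 1) → Z) := by
      funext p
      simp [MeasurableEquiv.piFinSuccAbove, Fin.insertNthEquiv]
    have hmp := he.symm
    have hemb :=
      (MeasurableEquiv.piFinSuccAbove (fun _ : Fin (n + 1) => Z) 0).symm.measurableEmbedding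
    rw [hcoe] at hmp hemb
    have hcons := hemb.measurable
    rw [← hmp.integral_comp hemb, ← hmp.integral_comp hemb]
    set Ξ : Z × (Fin n → Z) → ℝ := fun p => Ψ (Fin.cons p.1 p.2) with hΞ
    have hΞm : Measurable Ξ := hm.comp hcons
    have hΞB : ∀ p, |Ξ p| ≤ B := fun p => hB _
    have hΞi : Integrable Ξ (μ.prod ν) := integrable_of_abs_le hΞm hΞB
    -- Averaging out the first coordinate gives a function to which the induction hypothesis
    -- applies, while Hoeffding's lemma handles the fluctuation of `Ξ (·, y)` around `Ψ' y` for
    -- almost every `y`.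
    set Ψ' : (Fin n → Z) → ℝ := fun y => ∫ z, Ξ (z, y) ∂μ with hΨ'
    have hsec : ∀ y, Integrable (fun z => Ξ (z, y)) μ := fun y =>
      integrable_of_abs_le (hΞm.comp (measurable_id.prodMk measurable_const)) fun z => hΞB _
    have hΨ'm : Measurable Ψ' :=
      hΞm.stronglyMeasurable.integral_prod_left'.measurable
    have hΨ'B : ∀ y, |Ψ' y| ≤ B := fun y => by
      have := norm_integral_le_of_norm_le_const (μ := μ) (f := fun z => Ξ (z, y)) (C := B)
        (ae_of_all _ fun z => hΞB _)
      simpa using this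
    -- In `hc` the null set depends on the replacement point `z`. Fubini on triples `(z, y, w)`
    -- brings `y` to the front, so that almost every section satisfies the pairwise bound.
    have hc0 : ∀ᵐ y ∂ν, ∀ᵐ w ∂μ, ∀ᵐ z ∂μ, Ξ (w, y) ≤ Ξ (z, y) + c := by
      have h1 : ∀ z, ∀ᵐ y ∂ν, ∀ᵐ w ∂μ, Ξ (w, y) ≤ Ξ (z, y) + c := fun z => by
        have h := hmp.quasiMeasurePreserving.ae (hc 0 z)
        simp only [Fin.update_cons_zero] at h
        exact (Measure.ae_ae_comm (p := fun w y => Ξ (w, y) ≤ Ξ (z, y) + c)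
          (measurableSet_le hΞm ((hΞm.comp
            (measurable_const.prodMk measurable_snd)).add_const c))).mp
            (Measure.ae_ae_of_ae_prod h)
      have h2 : ∀ᵐ q ∂(μ.prod (ν.prod μ)), Ξ (q.2.2, q.2.1) ≤ Ξ (q.1, q.2.1) + c := by
        have hms : MeasurableSet
            {q : Z × (Fin n → Z) × Z | Ξ (q.2.2, q.2.1) ≤ Ξ (q.1, q.2.1) + c} :=
          measurableSet_le (by fun_prop) (by fun_prop)
        have hms' : ∀ z, MeasurableSet
            {q : (Fin n → Z) × Z | Ξ (q.2, q.1) ≤ Ξ (z, q.1) + c} := fun z =>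
          measurableSet_le (by fun_prop) (by fun_prop)
        exact (Measure.ae_prod_iff_ae_ae hms).mpr
          (ae_of_all _ fun z => (Measure.ae_prod_iff_ae_ae (hms' z)).mpr (h1 z))
      have h3 :=
        (Measure.measurePreserving_swap (μ := ν.prod μ) (ν := μ)).quasiMeasurePreserving.ae h2
      filter_upwards [Measure.ae_ae_of_ae_prod (Measure.ae_ae_of_ae_prod h3)] with y hy
      exact hy
    have hc' : ∀ i z, ∀ᵐ y ∂ν, Ψ' y ≤ Ψ' (Function.update y i z) + c := fun i z => by
      have h := hmp.quasiMeasurePreserving.ae (hc i.succ z)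
      simp only [← Fin.cons_update] at h
      have h' := (Measure.ae_ae_comm (p := fun w y => Ξ (w, y) ≤ Ξ (w, Function.update y i z) + c)
        (measurableSet_le hΞm ((hΞm.comp (measurable_fst.prodMk
          (measurable_update_left.comp measurable_snd))).add_const c))).mp
            (Measure.ae_ae_of_ae_prod h)
      filter_upwards [h'] with y hy
      calc Ψ' y ≤ ∫ w, (Ξ (w, Function.update y i z) + c) ∂μ :=
            integral_mono_ae (hsec y) ((hsec _).add (integrable_const c)) hy
        _ = _ := by rw [integral_add (hsec _) (integrable_const c)]; simp [hΨ']
    have hE : ∫ p, Ξ p ∂(μ.prod ν) = ∫ y, Ψ' y ∂ν := integral_prod_symm _ hΞi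
    have hih := ih Ψ' hΨ'm hΨ'B hc'
    rw [hE]
    set e := ∫ y, Ψ' y ∂ν with he
    have heB : |e| ≤ B := by
      have := norm_integral_le_of_norm_le_const (μ := ν) (f := Ψ') (C := B) (ae_of_all _ hΨ'B)
      simpa using this
    have hexp : ∀ x : ℝ, |x| ≤ B → |Real.exp (t * (x - e))| ≤ Real.exp (|t| * (2 * B)) := by
      intro x hx
      rw [abs_of_pos (Real.exp_pos _), Real.exp_le_exp]
      refine (le_abs_self _).trans ?_
      rw [abs_mul]
      refine mul_le_mul_of_nonneg_left ?_ (abs_nonneg _)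
      linarith [abs_sub x e]
    have hexpi : Integrable (fun p => Real.exp (t * (Ξ p - e))) (μ.prod ν) :=
      integrable_of_abs_le (by fun_prop) fun p => hexp _ (hΞB p)
    calc ∫ p, Real.exp (t * (Ξ p - e)) ∂(μ.prod ν)
        = ∫ y, ∫ z, Real.exp (t * (Ξ (z, y) - e)) ∂μ ∂ν := integral_prod_symm _ hexpi
      _ ≤ ∫ y, Real.exp (t ^ 2 * c ^ 2 / 8) * Real.exp (t * (Ψ' y - e)) ∂ν := by
          refine integral_mono_ae hexpi.integral_prod_right
            ((integrable_of_abs_le (by fun_prop) fun y => hexp _ (hΨ'B y)).const_mul _) ?_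
          filter_upwards [hc0] with y hy
          have h := integral_exp_le_of_ae_pairs μ (fun z => Ξ (z, y))
            (hΞm.comp (measurable_id.prodMk measurable_const)) B c (fun z => hΞB _) hy t
          calc ∫ z, Real.exp (t * (Ξ (z, y) - e)) ∂μ
              = (∫ z, Real.exp (t * (Ξ (z, y) - Ψ' y)) ∂μ) * Real.exp (t * (Ψ' y - e)) := by
                rw [← integral_mul_const]
                refine integral_congr_ae (ae_of_all _ fun z => ?_)
                simp only [← Real.exp_add]
                ring_nf
            _ ≤ _ := mul_le_mul_of_nonneg_right h (Real.exp_pos _).le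
      _ ≤ Real.exp (t ^ 2 * c ^ 2 / 8) * Real.exp (n * (t ^ 2 * c ^ 2 / 8)) := by
          rw [integral_const_mul]
          exact mul_le_mul_of_nonneg_left hih (Real.exp_pos _).le
      _ = _ := by
          rw [← Real.exp_add]
          push_cast
          ring_nf

/-- McDiarmid's inequality, for differences that are bounded up to null sets. -/
theorem measure_add_le_of_bounded_differences {Z : Type*} [MeasurableSpace Z] (μ : Measure Z)
    [IsProbabilityMeasure μ] {n : ℕ} (hn : 0 < n) (Ψ : (Fin n → Z) → ℝ) (hm : Measurable Ψ)
    (B c : ℝ) (hc0 : 0 < c) (hB : ∀ S, |Ψ S| ≤ B)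
    (hc : ∀ i z, ∀ᵐ S ∂(Measure.pi fun _ => μ), Ψ S ≤ Ψ (Function.update S i z) + c)
    (s : ℝ) (hs : 0 ≤ s) :
    (Measure.pi fun _ => μ).real {S | (∫ S, Ψ S ∂(Measure.pi fun _ => μ)) + s ≤ Ψ S} ≤
      Real.exp (-(2 * s ^ 2 / (n * c ^ 2))) := by
  set ν : Measure (Fin n → Z) := Measure.pi fun _ => μ with hν
  set e := ∫ S, Ψ S ∂ν with he
  have hn' : (0 : ℝ) < n := by exact_mod_cast hn
  -- The minimizer of the Chernoff exponent `-t s + n t² c² / 8`.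
  set t := 4 * s / (n * c ^ 2) with ht
  have ht0 : 0 ≤ t := by positivity
  have hi : Integrable (fun S => Real.exp (t * (Ψ S - e))) ν := by
    refine integrable_of_abs_le (B := Real.exp (t * (B - e))) (by fun_prop) fun S => ?_
    rw [abs_of_pos (Real.exp_pos _), Real.exp_le_exp]
    exact mul_le_mul_of_nonneg_left (by linarith [(abs_le.mp (hB S)).2]) ht0
  have h := ProbabilityTheory.measure_ge_le_exp_mul_mgf (μ := ν) (X := fun S => Ψ S - e) s ht0 hi
  have hset : {S | e + s ≤ Ψ S} = {S | s ≤ Ψ S - e} := by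
    ext S; simp only [Set.mem_ofPred_eq]; constructor <;> intro h <;> linarith
  rw [hset]
  refine h.trans ((mul_le_mul_of_nonneg_left
    (integral_exp_le_of_bounded_differences μ Ψ hm B c hB hc t) (Real.exp_pos _).le).trans ?_)
  rw [← Real.exp_add, Real.exp_le_exp]
  refine le_of_eq ?_
  rw [ht]
  field_simp
  ring

/-! ### Symmetrization -/

/-- Exchange the `i`-th points of two samples whenever `σ i = 1`. -/
def signSwap {Z : Type*} {n : ℕ} (σ : Fin n → ℤˣ) (p : (Fin n → Z) × (Fin n → Z)) :
    (Fin n → Z) × (Fin n → Z) :=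
  (fun i => if σ i = 1 then p.2 i else p.1 i, fun i => if σ i = 1 then p.1 i else p.2 i)

/-- Regrouped as `n` independent pairs, the two samples are altered only by swaps of some pairs, and
each swap preserves `μ.prod μ`. -/
theorem measurePreserving_signSwap {Z : Type*} [MeasurableSpace Z] (μ : Measure Z)
    [IsProbabilityMeasure μ] {n : ℕ} (σ : Fin n → ℤˣ) :
    MeasurePreserving (signSwap (Z := Z) σ)
      ((Measure.pi fun _ => μ).prod (Measure.pi fun _ => μ))
      ((Measure.pi fun _ => μ).prod (Measure.pi fun _ => μ)) := by
  have he := measurePreserving_arrowProdEquivProdArrow Z Z (Fin n) (fun _ => μ) (fun _ => μ)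
  have h1 : MeasurePreserving
      (fun (q : Fin n → Z × Z) i => (if σ i = 1 then Prod.swap else id) (q i))
      (Measure.pi fun _ => μ.prod μ) (Measure.pi fun _ => μ.prod μ) := by
    refine measurePreserving_pi (fun _ => μ.prod μ) (fun _ => μ.prod μ) fun i => ?_
    split_ifs
    · exact Measure.measurePreserving_swap
    · exact MeasurePreserving.id _
  convert he.comp (h1.comp he.symm) using 1
  funext p
  refine Prod.ext (funext fun i => ?_) (funext fun i => ?_) <;>
  · by_cases h : σ i = 1 <;>
      simp [signSwap, h, MeasurableEquiv.arrowProdEquivProdArrow, Equiv.arrowProdEquivProdArrow]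

/-- Symmetrization: measurable majorants of the signed sums give a measurable majorant of the
uniform deviation. -/
theorem exists_majorant_deviation {Z : Type*} [MeasurableSpace Z] (μ : Measure Z)
    [IsProbabilityMeasure μ] {ι : Type*} (h : ι → Z → ℝ) (hm : ∀ f, Measurable (h f)) (M : ℝ)
    (hM : ∀ f z, |h f z| ≤ M) {n : ℕ} (G : (Fin n → ℤˣ) → (Fin n → Z) → ℝ) (B : ℝ)
    (hGm : ∀ σ, Measurable (G σ)) (hGB : ∀ σ S, |G σ S| ≤ B)
    (hG : ∀ σ f S, ∑ i, ((σ i : ℤ) : ℝ) * h f (S i) ≤ G σ S) :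
    ∃ C : (Fin n → Z) → ℝ, Measurable C ∧ (∀ S, |C S| ≤ 2 * B) ∧
      (∀ f S, ∑ i, ((∫ z, h f z ∂μ) - h f (S i)) ≤ C S) ∧
      ∫ S, C S ∂(Measure.pi fun _ => μ) =
        2 * (1 / 2 ^ n * ∑ σ, ∫ S, G σ S ∂(Measure.pi fun _ => μ)) := by
  set ν : Measure (Fin n → Z) := Measure.pi fun _ => μ with hν
  -- For every `σ`, the sum of `h (S' i) - h (S i)` equals the `σ`-signed sum over the first swapped
  -- sample plus the `-σ`-signed sum over the second, hence is at most `H σ (S, S')`. The swap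
  -- preserves the law, so `H σ` integrates to the means of `G σ` and `G (-σ)`; averaging over `σ`
  -- gives the factor 2.
  set H : (Fin n → ℤˣ) → (Fin n → Z) × (Fin n → Z) → ℝ := fun σ p =>
    G σ (signSwap σ p).1 + G (-σ) (signSwap σ p).2 with hH
  have hs : ∀ σ : Fin n → ℤˣ, Measurable (signSwap (Z := Z) σ) := fun σ =>
    (measurePreserving_signSwap μ σ).measurable
  have hHm : ∀ σ, Measurable (H σ) := fun σ =>
    ((hGm σ).comp (measurable_fst.comp (hs σ))).add ((hGm (-σ)).comp (measurable_snd.comp (hs σ)))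
  have hHB : ∀ σ p, |H σ p| ≤ 2 * B := fun σ p =>
    (abs_add_le _ _).trans (by linarith [hGB σ (signSwap σ p).1, hGB (-σ) (signSwap σ p).2])
  have hcard : Fintype.card (Fin n → ℤˣ) = 2 ^ n := by simp
  have hsum : ∀ a : ℝ, 1 / 2 ^ n * ∑ _σ : Fin n → ℤˣ, a = a := fun a => by
    rw [Finset.sum_const, Finset.card_univ, hcard, nsmul_eq_mul]
    push_cast
    field_simp
  have hsec : ∀ σ S, Integrable (fun S' => H σ (S, S')) ν := fun σ S =>
    integrable_of_abs_le ((hHm σ).comp measurable_prodMk_left) fun S' => hHB σ _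
  have hIm : ∀ σ, Measurable fun S => ∫ S', H σ (S, S') ∂ν := fun σ =>
    (hHm σ).stronglyMeasurable.integral_prod_right'.measurable
  have hIB : ∀ σ S, |∫ S', H σ (S, S') ∂ν| ≤ 2 * B := fun σ S => by
    have := norm_integral_le_of_norm_le_const (μ := ν) (f := fun S' => H σ (S, S')) (C := 2 * B)
      (ae_of_all _ fun S' => hHB σ _)
    simpa using this
  have hHi : ∀ σ, ∫ S, ∫ S', H σ (S, S') ∂ν ∂ν = ∫ S, G σ S ∂ν + ∫ S, G (-σ) S ∂ν := fun σ => by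
    have hGi := fun σ => integrable_of_abs_le (μ := ν) (hGm σ) (hGB σ)
    rw [← integral_prod _ (integrable_of_abs_le (hHm σ) (hHB σ))]
    have hi1 : Integrable (fun p : (Fin n → Z) × (Fin n → Z) => G σ p.1) (ν.prod ν) :=
      integrable_of_abs_le ((hGm _).comp measurable_fst) fun p => hGB _ _
    have hi2 : Integrable (fun p : (Fin n → Z) × (Fin n → Z) => G (-σ) p.2) (ν.prod ν) :=
      integrable_of_abs_le ((hGm _).comp measurable_snd) fun p => hGB _ _
    have hmap := (measurePreserving_signSwap μ σ).map_eq
    have : ∫ p, H σ p ∂(ν.prod ν) = ∫ p, (G σ p.1 + G (-σ) p.2) ∂(ν.prod ν) := by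
      conv_rhs => rw [← hmap]
      rw [integral_map (hs σ).aemeasurable]
      rw [hmap]
      exact (hi1.add hi2).aestronglyMeasurable
    rw [this, integral_add hi1 hi2, integral_fun_fst (fun S => G σ S),
      integral_fun_snd (fun S => G (-σ) S)]
    simp
  refine ⟨fun S => 1 / 2 ^ n * ∑ σ, ∫ S', H σ (S, S') ∂ν, ?_, fun S => ?_, fun f S => ?_, ?_⟩
  · exact (Finset.measurable_sum _ fun σ _ => hIm σ).const_mul _
  · rw [abs_mul, abs_of_pos (by positivity : (0 : ℝ) < 1 / 2 ^ n), ← hsum (2 * B)]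
    refine mul_le_mul_of_nonneg_left ?_ (by positivity)
    exact (Finset.abs_sum_le_sum_abs _ _).trans (Finset.sum_le_sum fun σ _ => hIB σ S)
  · rw [← hsum (∑ i, ((∫ z, h f z ∂μ) - h f (S i)))]
    refine mul_le_mul_of_nonneg_left (Finset.sum_le_sum fun σ _ => ?_) (by positivity)
    have hint : ∀ i, Integrable (fun S' : Fin n → Z => h f (S' i)) ν := fun i =>
      integrable_of_abs_le ((hm f).comp (measurable_pi_apply i)) fun S' => hM f _
    have hd : ∀ i, Integrable (fun S' : Fin n → Z => h f (S' i) - h f (S i)) ν := fun i =>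
      (hint i).sub (integrable_const _)
    have hcomp : ∀ i, ∫ S', h f (S' i) ∂ν = ∫ z, h f z ∂μ := fun i =>
      integral_comp_eval (μ := fun _ : Fin n => μ) (i := i) (hm f).aestronglyMeasurable
    have heq : ∑ i, ((∫ z, h f z ∂μ) - h f (S i)) = ∫ S', ∑ i, (h f (S' i) - h f (S i)) ∂ν := by
      rw [integral_finsetSum _ fun i _ => hd i]
      refine Finset.sum_congr rfl fun i _ => ?_
      rw [integral_sub (hint i) (integrable_const _), hcomp i]
      simp
    rw [heq]
    refine integral_mono (integrable_finsetSum _ fun i _ => hd i)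
      (hsec σ S) fun S' => ?_
    refine le_trans (le_of_eq ?_) (add_le_add (hG σ f (signSwap σ (S, S')).1)
      (hG (-σ) f (signSwap σ (S, S')).2))
    rw [← Finset.sum_add_distrib]
    refine Finset.sum_congr rfl fun i _ => ?_
    rcases Int.units_eq_one_or (σ i) with hi | hi <;> simp [signSwap, hi] <;> ring
  · rw [integral_const_mul, integral_finsetSum _ fun σ _ => integrable_of_abs_le (hIm σ) (hIB σ)]
    have hneg := Equiv.sum_comp (Equiv.neg (Fin n → ℤˣ)) fun σ => ∫ S, G σ S ∂ν
    simp only [Equiv.neg_apply] at hneg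
    simp only [hHi]
    rw [Finset.sum_add_distrib, hneg]
    ring

/-! ### Discretization of the values, and majorants of signed sums -/

theorem abs_sum_signs_mul_le {n : ℕ} (σ : Fin n → ℤˣ) (v : Fin n → ℝ) (B : ℝ)
    (hv : ∀ i, |v i| ≤ B) : |∑ i, ((σ i : ℤ) : ℝ) * v i| ≤ n * B := by
  refine (Finset.abs_sum_le_sum_abs _ _).trans ?_
  calc ∑ i, |((σ i : ℤ) : ℝ) * v i| ≤ ∑ _i : Fin n, B := Finset.sum_le_sum fun i _ => by
        rcases Int.units_eq_one_or (σ i) with hi | hi <;> simp [hi, hv i]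
    _ = n * B := by simp

/-- Rounding down to multiples of `1 / N`; the value 1 requires the last of the `N + 1` grid points.
-/
theorem exists_grid_point {n N : ℕ} (hN : 0 < N) (v : Fin n → ℝ)
    (hv : ∀ i, v i ∈ Set.Icc (0 : ℝ) 1) :
    ∃ q : Fin n → Fin (N + 1), ∀ i, |v i - (q i : ℝ) / N| ≤ 1 / N := by
  have hN' : (0 : ℝ) < N := by exact_mod_cast hN
  have hlt : ∀ i, ⌊v i * N⌋₊ < N + 1 := fun i => by
    rw [Nat.lt_succ_iff]
    refine Nat.floor_le_of_le ?_
    have := mul_le_mul_of_nonneg_right (hv i).2 hN'.le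
    linarith
  refine ⟨fun i => ⟨⌊v i * N⌋₊, hlt i⟩, fun i => ?_⟩
  have h1 := Nat.floor_le (mul_nonneg (hv i).1 hN'.le)
  have h2 := Nat.lt_floor_add_one (v i * N)
  have h3 : v i - (⌊v i * N⌋₊ : ℝ) / N = (v i * N - ⌊v i * N⌋₊) / N := by field_simp
  dsimp only
  rw [h3, abs_div, abs_of_pos hN', abs_of_nonneg (by linarith)]
  gcongr
  linarith

/-- Measurable majorants of the signed sums of `ψ ∘ u`, whose expectations are controlled by the
Rademacher averages of `u`. Only the latter are assumed to be measurable: the set of value vectors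
`(u f (S i))ᵢ` is covered by finitely many measurable sets before the contraction principle is
applied. -/
theorem exists_signed_majorant {Z : Type*} [MeasurableSpace Z] (μ : Measure Z)
    [IsProbabilityMeasure μ] {ι : Type*} [Nonempty ι] (u : ι → Z → ℝ)
    (hu : ∀ f z, u f z ∈ Set.Icc (0 : ℝ) 1) (ψ : Z → ℝ → ℝ) (hψm : ∀ t, Measurable fun z => ψ z t)
    (K B : ℝ) (hK : 0 ≤ K) (hψ : ∀ z s t, |ψ z s - ψ z t| ≤ K * |s - t|)
    (hψB : ∀ z, ∀ t ∈ Set.Icc (0 : ℝ) 1, |ψ z t| ≤ B) {n : ℕ} (hn : 0 < n)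
    (hsup : ∀ σ : Fin n → ℤˣ, AEMeasurable
      (fun S : Fin n → Z => ⨆ f, (1 / (n : ℝ)) * ∑ i, ((σ i : ℤ) : ℝ) * u f (S i))
      (Measure.pi fun _ => μ)) {N : ℕ} (hN : 0 < N) :
    ∃ (G : (Fin n → ℤˣ) → (Fin n → Z) → ℝ) (D : ℝ), (∀ σ, Measurable (G σ)) ∧
      (∀ σ S, |G σ S| ≤ D) ∧ (∀ σ f S, ∑ i, ((σ i : ℤ) : ℝ) * ψ (S i) (u f (S i)) ≤ G σ S) ∧
      1 / 2 ^ n * ∑ σ, ∫ S, G σ S ∂(Measure.pi fun _ => μ) ≤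
        n * K * (∫ S, 1 / 2 ^ n * ∑ σ : Fin n → ℤˣ,
          (⨆ f, (1 / (n : ℝ)) * ∑ i, ((σ i : ℤ) : ℝ) * u f (S i)) ∂(Measure.pi fun _ => μ)) +
        2 * n * K / N := by
  classical
  have hN' : (0 : ℝ) < N := by exact_mod_cast hN
  have hn' : (0 : ℝ) < n := by exact_mod_cast hn
  set ν : Measure (Fin n → Z) := Measure.pi fun _ => μ with hν
  set s : (Fin n → ℤˣ) → (Fin n → Z) → ℝ := fun σ S =>
    ⨆ f, (1 / (n : ℝ)) * ∑ i, ((σ i : ℤ) : ℝ) * u f (S i) with hs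
  have hterm : ∀ (σ : Fin n → ℤˣ) f (S : Fin n → Z),
      |(1 / (n : ℝ)) * ∑ i, ((σ i : ℤ) : ℝ) * u f (S i)| ≤ 1 := fun σ f S => by
    have h := abs_sum_signs_mul_le σ (fun i => u f (S i)) 1 fun i => by
      rw [abs_le]; constructor <;> linarith [(hu f (S i)).1, (hu f (S i)).2]
    rw [abs_mul, abs_of_pos (by positivity : (0 : ℝ) < 1 / n)]
    calc 1 / (n : ℝ) * _ ≤ 1 / (n : ℝ) * (n * 1) := by gcongr
      _ = 1 := by field_simp
  have hbdd : ∀ (σ : Fin n → ℤˣ) (S : Fin n → Z),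
      BddAbove (Set.range fun f => (1 / (n : ℝ)) * ∑ i, ((σ i : ℤ) : ℝ) * u f (S i)) :=
    fun σ S => ⟨1, by rintro _ ⟨f, rfl⟩; exact (abs_le.mp (hterm σ f S)).2⟩
  have hle_s : ∀ σ f S, ∑ i, ((σ i : ℤ) : ℝ) * u f (S i) ≤ n * s σ S := fun σ f S => by
    have h := mul_le_mul_of_nonneg_left (le_ciSup (hbdd σ S) f) hn'.le
    rwa [← mul_assoc, mul_one_div_cancel hn'.ne', one_mul] at h
  have hsB : ∀ σ S, |s σ S| ≤ 1 := fun σ S => by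
    obtain ⟨f⟩ := ‹Nonempty ι›
    exact abs_le.mpr ⟨(abs_le.mp (hterm σ f S)).1.trans (le_ciSup (hbdd σ S) f),
      ciSup_le fun f => (abs_le.mp (hterm σ f S)).2⟩
  have hsi : ∀ σ, Integrable (s σ) ν := fun σ =>
    Integrable.of_bound (hsup σ).aestronglyMeasurable 1 (ae_of_all _ (hsB σ))
  set g : (Fin n → Fin (N + 1)) → Fin n → ℝ := fun q i => (q i : ℝ) / N with hg
  have hg01 : ∀ q i, g q i ∈ Set.Icc (0 : ℝ) 1 := fun q i => by
    refine ⟨by positivity, ?_⟩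
    rw [hg, div_le_one hN']
    exact_mod_cast Nat.lt_succ_iff.mp (q i).2
  set T : (Fin n → Fin (N + 1)) → Set (Fin n → Z) := fun q =>
    {S | ∃ f, ∀ i, |u f (S i) - g q i| ≤ 1 / N} with hT
  -- `T q` need not be measurable, so its measurable hull is used. Outside the hull the grid point
  -- `q` is switched off by an offset independent of the signs, as contraction requires. The size `2
  -- K n` suffices because the `K`-scaled signed sum is at most `K n`, while `n K s σ S ≥ -K n`.
  set off : (Fin n → Fin (N + 1)) → (Fin n → Z) → ℝ := fun q S =>
    if S ∈ toMeasurable ν (T q) then 0 else -(2 * K * n) with hoff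
  have hoffm : ∀ q, Measurable (off q) := fun q =>
    Measurable.ite (measurableSet_toMeasurable _ _) measurable_const measurable_const
  have hoffB : ∀ q S, |off q S| ≤ 2 * K * n := fun q S => by
    have : 0 ≤ 2 * K * n := by positivity
    simp only [hoff]
    split_ifs
    · simpa using this
    · rw [abs_neg, abs_of_nonneg this]
  set V : (Fin n → ℤˣ) → (Fin n → Fin (N + 1)) → (Fin n → Z) → ℝ := fun σ q S =>
    off q S + ∑ i, ((σ i : ℤ) : ℝ) * ψ (S i) (g q i) with hV
  have hVm : ∀ σ q, Measurable (V σ q) := fun σ q => (hoffm q).add <|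
    Finset.measurable_sum _ fun i _ => ((hψm (g q i)).comp (measurable_pi_apply i)).const_mul _
  have hVB : ∀ σ q S, |V σ q S| ≤ 2 * K * n + n * B := fun σ q S =>
    (abs_add_le _ _).trans (add_le_add (hoffB q S)
      (abs_sum_signs_mul_le σ _ B fun i => hψB _ _ (hg01 q i)))
  set P : (Fin n → ℤˣ) → (Fin n → Z) → ℝ := fun σ S =>
    Finset.univ.sup' Finset.univ_nonempty fun q => V σ q S with hP
  have hPm : ∀ σ, Measurable (P σ) := fun σ => by
    have h := Finset.measurable_sup' Finset.univ_nonempty fun q _ => hVm σ q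
    convert h using 1
    funext S
    exact (Finset.sup'_apply _ _ _).symm
  have hPB : ∀ σ S, |P σ S| ≤ 2 * K * n + n * B := fun σ S => by
    rw [abs_le]
    exact ⟨(abs_le.mp (hVB σ (fun _ => 0) S)).1.trans
        (Finset.le_sup' (fun q => V σ q S) (Finset.mem_univ _)),
      Finset.sup'_le _ _ fun q _ => (abs_le.mp (hVB σ q S)).2⟩
  have hcover : ∀ σ q, ∀ᵐ S ∂ν, S ∈ toMeasurable ν (T q) →
      ∑ i, ((σ i : ℤ) : ℝ) * g q i ≤ n * s σ S + n / N := fun σ q => by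
    have hae := (hsup σ).ae_eq_mk
    set s' := (hsup σ).mk with hs'
    have hT' : ∀ S ∈ T q, ∑ i, ((σ i : ℤ) : ℝ) * g q i ≤ n * s σ S + n / N := by
      rintro S ⟨f, hf⟩
      have h1 := abs_sum_signs_mul_le σ (fun i => g q i - u f (S i)) (1 / N) fun i => by
        rw [abs_sub_comm]; exact hf i
      have h2 := (abs_le.mp h1).2
      simp only [mul_sub, Finset.sum_sub_distrib] at h2
      have h3 := hle_s σ f S
      rw [mul_one_div] at h2
      linarith
    -- With the measurable version `s'` the violating set is measurable. It meets `T q` in a null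
    -- set, so it also meets the hull of `T q` in a null set.
    have hBm : MeasurableSet {S | ¬ (∑ i, ((σ i : ℤ) : ℝ) * g q i ≤ n * s' S + n / N)} :=
      (measurableSet_le measurable_const
        (((hsup σ).measurable_mk.const_mul _).add_const _)).compl
    have h0 : ν (T q ∩ {S | ¬ (∑ i, ((σ i : ℤ) : ℝ) * g q i ≤ n * s' S + n / N)}) = 0 := by
      refine measure_mono_null ?_ (ae_iff.mp hae)
      rintro S ⟨hS, hS'⟩ heq
      refine hS' ?_
      rw [← heq]
      exact hT' S hS
    rw [← Measure.measure_toMeasurable_inter hBm (measure_ne_top _ _)] at h0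
    have h0' : ∀ᵐ S ∂ν, S ∉ toMeasurable ν (T q) ∩
        {S | ¬ (∑ i, ((σ i : ℤ) : ℝ) * g q i ≤ n * s' S + n / N)} :=
      measure_eq_zero_iff_ae_notMem.mp h0
    filter_upwards [hae, h0'] with S hS hS0 hST
    by_contra hcon
    refine hS0 ⟨hST, fun hle => hcon ?_⟩
    rw [← hS] at hle
    exact hle
  have hpoint : ∀ᵐ S ∂ν, ∑ σ, P σ S ≤ ∑ σ, (n * K * s σ S + n * K / N) := by
    have hall : ∀ᵐ S ∂ν, ∀ σ q, S ∈ toMeasurable ν (T q) →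
        ∑ i, ((σ i : ℤ) : ℝ) * g q i ≤ n * s σ S + n / N :=
      ae_all_iff.mpr fun σ => ae_all_iff.mpr fun q => hcover σ q
    filter_upwards [hall] with S hS
    refine (contraction (fun q => off q S) (fun i q => ψ (S i) (g q i)) (fun i q => K * g q i)
      fun i q q' => ?_).trans (Finset.sum_le_sum fun σ _ => Finset.sup'_le _ _ fun q _ => ?_)
    · rw [← mul_sub, abs_mul, abs_of_nonneg hK]
      exact hψ _ _ _
    · have hfac : ∑ i, ((σ i : ℤ) : ℝ) * (K * g q i) = K * ∑ i, ((σ i : ℤ) : ℝ) * g q i := by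
        rw [Finset.mul_sum]
        exact Finset.sum_congr rfl fun i _ => by ring
      rw [hfac]
      by_cases hq : S ∈ toMeasurable ν (T q)
      · simp only [hoff, if_pos hq, zero_add]
        refine (mul_le_mul_of_nonneg_left (hS σ q hq) hK).trans (le_of_eq ?_)
        ring
      · simp only [hoff, if_neg hq]
        have h1 := abs_sum_signs_mul_le σ (g q) 1 fun i => by
          rw [abs_le]; constructor <;> linarith [(hg01 q i).1, (hg01 q i).2]
        have h2 := mul_le_mul_of_nonneg_left (abs_le.mp h1).2 hK
        have h3 := mul_le_mul_of_nonneg_left (abs_le.mp (hsB σ S)).1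
          (by positivity : (0 : ℝ) ≤ n * K)
        have h4 : 0 ≤ n * K / N := by positivity
        linarith
  -- The added `n K / N` pays for rounding inside `ψ`; the same amount from `hpoint`, for rounding
  -- inside the signed sums of `u`, completes the error `2 n K / N`.
  refine ⟨fun σ S => P σ S + n * K / N, 2 * K * n + n * B + n * K / N, fun σ =>
    (hPm σ).add_const _, fun σ S => ?_, fun σ f S => ?_, ?_⟩
  · refine (abs_add_le _ _).trans (add_le_add (hPB σ S) ?_)
    rw [abs_of_nonneg (by positivity)]
  · obtain ⟨q, hq⟩ := exists_grid_point hN (fun i => u f (S i)) fun i => hu f (S i)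
    have hqT : S ∈ toMeasurable ν (T q) := subset_toMeasurable _ _ ⟨f, hq⟩
    have h1 : V σ q S ≤ P σ S := Finset.le_sup' (fun q => V σ q S) (Finset.mem_univ q)
    have h2 := abs_sum_signs_mul_le σ (fun i => ψ (S i) (u f (S i)) - ψ (S i) (g q i)) (K / N)
      fun i => (hψ _ _ _).trans
        ((mul_le_mul_of_nonneg_left (hq i) hK).trans (le_of_eq (by ring)))
    have h3 := (abs_le.mp h2).2
    simp only [mul_sub, Finset.sum_sub_distrib] at h3
    simp only [hV, hoff, if_pos hqT, zero_add] at h1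
    rw [← mul_div_assoc] at h3
    linarith
  · have hPi : ∀ σ, Integrable (P σ) ν := fun σ => integrable_of_abs_le (hPm σ) (hPB σ)
    have hcard : (Fintype.card (Fin n → ℤˣ) : ℝ) = 2 ^ n := by simp
    have h1 := integral_mono_ae (integrable_finsetSum _ fun σ _ => hPi σ)
      (integrable_finsetSum _ fun σ _ => ((hsi σ).const_mul (n * K)).add
        (integrable_const (n * K / N))) hpoint
    rw [integral_finsetSum _ fun σ _ => hPi σ, integral_finsetSum _ fun σ _ =>
      ((hsi σ).const_mul (n * K)).add (integrable_const (n * K / N))] at h1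
    have h3 : ∀ σ, ∫ S, (n * K * s σ S + n * K / N) ∂ν = n * K * ∫ S, s σ S ∂ν + n * K / N :=
      fun σ => by
        rw [integral_add ((hsi σ).const_mul _) (integrable_const _), integral_const_mul]
        simp
    have h4 : ∀ σ, ∫ S, (P σ S + n * K / N) ∂ν = ∫ S, P σ S ∂ν + n * K / N :=
      fun σ => by
        rw [integral_add (hPi σ) (integrable_const _)]
        simp
    simp only [h4]
    rw [integral_const_mul, integral_finsetSum _ fun σ _ => hsi σ]
    simp only [Pi.add_apply, h3] at h1
    rw [Finset.sum_add_distrib, ← Finset.mul_sum, Finset.sum_const, Finset.card_univ,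
      nsmul_eq_mul, hcard] at h1
    rw [Finset.sum_add_distrib, Finset.sum_const, Finset.card_univ, nsmul_eq_mul, hcard]
    have h5 := mul_le_mul_of_nonneg_left h1 (by positivity : (0 : ℝ) ≤ 1 / 2 ^ n)
    have h6 : (1 : ℝ) / 2 ^ n * (2 ^ n * (n * K / N)) = n * K / N := by field_simp
    rw [mul_add, h6] at h5 ⊢
    have h7 : 2 * n * K / N = n * K / N + n * K / N := by ring
    rw [h7]
    linarith

/-! ### The uniform deviation bound -/

/-- With probability at least `1 - δ`, the excess of `E h - Ê h` over its value at a reference member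
of the class is bounded for all `h = ψ ∘ u f` at once by the Rademacher average of `u`. -/
theorem exists_event_deviation_le {Z : Type*} [MeasurableSpace Z] (μ : Measure Z)
    [IsProbabilityMeasure μ] {ι : Type*} (f₀ : ι) (u : ι → Z → ℝ)
    (hu : ∀ f z, u f z ∈ Set.Icc (0 : ℝ) 1) (ψ : Z → ℝ → ℝ) (hψm : ∀ t, Measurable fun z => ψ z t)
    (K B M : ℝ) (hK : 0 ≤ K) (hψ : ∀ z s t, |ψ z s - ψ z t| ≤ K * |s - t|)
    (hψB : ∀ z, ∀ t ∈ Set.Icc (0 : ℝ) 1, |ψ z t| ≤ B)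
    (hm : ∀ f, Measurable fun z => ψ z (u f z)) (hM : 0 < M)
    (hψM : ∀ f z, ψ z (u f z) ∈ Set.Icc 0 M) {n : ℕ} (hn : 0 < n)
    (hsup : ∀ σ : Fin n → ℤˣ, AEMeasurable
      (fun S : Fin n → Z => ⨆ f, (1 / (n : ℝ)) * ∑ i, ((σ i : ℤ) : ℝ) * u f (S i))
      (Measure.pi fun _ => μ)) (δ : ℝ) (hδ : 0 < δ) (hδ1 : δ < 1) :
    ∃ E : Set (Fin n → Z), MeasurableSet E ∧ ENNReal.ofReal (1 - δ) ≤ (Measure.pi fun _ => μ) E ∧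
      ∀ S ∈ E, ∀ f, ((∫ z, ψ z (u f z) ∂μ) - (1 / (n : ℝ)) * ∑ i, ψ (S i) (u f (S i))) -
          ((∫ z, ψ z (u f₀ z) ∂μ) - (1 / (n : ℝ)) * ∑ i, ψ (S i) (u f₀ (S i))) ≤
        2 * K * (∫ S, 1 / 2 ^ n * ∑ σ : Fin n → ℤˣ,
          (⨆ f, (1 / (n : ℝ)) * ∑ i, ((σ i : ℤ) : ℝ) * u f (S i)) ∂(Measure.pi fun _ => μ)) +
        2 * M * √(Real.log (2 / δ) / (2 * (n : ℝ))) := by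
  have : Nonempty ι := ⟨f₀⟩
  have hn' : (0 : ℝ) < n := by exact_mod_cast hn
  set ν : Measure (Fin n → Z) := Measure.pi fun _ => μ with hν
  set rad := ∫ S, 1 / 2 ^ n * ∑ σ : Fin n → ℤˣ,
          (⨆ f, (1 / (n : ℝ)) * ∑ i, ((σ i : ℤ) : ℝ) * u f (S i)) ∂ν with hrad
  set h : ι → Z → ℝ := fun f z => ψ z (u f z) with hh
  have hhM : ∀ f z, |h f z| ≤ M := fun f z => by
    rw [abs_of_nonneg (hψM f z).1]; exact (hψM f z).2
  set e : ι → (Fin n → Z) → ℝ := fun f S => (1 / (n : ℝ)) * ∑ i, h f (S i) with he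
  have hem : ∀ f, Measurable (e f) := fun f =>
    (Finset.measurable_sum _ fun i _ => (hm f).comp (measurable_pi_apply i)).const_mul _
  have hei : ∀ f S, e f S ∈ Set.Icc 0 M := fun f S => by
    refine ⟨mul_nonneg (by positivity) (Finset.sum_nonneg fun i _ => (hψM f _).1), ?_⟩
    calc e f S ≤ (1 / (n : ℝ)) * ∑ _i : Fin n, M :=
          mul_le_mul_of_nonneg_left (Finset.sum_le_sum fun i _ => (hψM f _).2) (by positivity)
      _ = M := by simp; field_simp
  set R : ι → ℝ := fun f => ∫ z, h f z ∂μ with hR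
  have hRi : ∀ f, R f ∈ Set.Icc 0 M := fun f => by
    refine ⟨integral_nonneg fun z => (hψM f z).1, ?_⟩
    calc R f ≤ ∫ _z, M ∂μ := integral_mono (integrable_of_abs_le (hm f) (hhM f))
          (integrable_const M) fun z => (hψM f z).2
      _ = M := by simp
  -- Putting the reference term inside the supremum leaves a single one-sided event to control. The
  -- price is a difference bound of `2 M / n`, as both empirical means can move by `M / n`.
  set dev : ι → (Fin n → Z) → ℝ := fun f S => (R f - e f S) - (R f₀ - e f₀ S) with hdev
  have hdevB : ∀ f S, |dev f S| ≤ 2 * M := fun f S => by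
    have := hei f S; have := hei f₀ S; have := hRi f; have := hRi f₀
    simp only [Set.mem_Icc] at *
    rw [abs_le]; constructor <;> simp only [hdev] <;> linarith
  have hbdd : ∀ S, BddAbove (Set.range fun f => dev f S) := fun S =>
    ⟨2 * M, by rintro _ ⟨f, rfl⟩; exact (abs_le.mp (hdevB f S)).2⟩
  have hΦB : ∀ S, |⨆ f, dev f S| ≤ 2 * M := fun S =>
    abs_le.mpr ⟨(abs_le.mp (hdevB f₀ S)).1.trans (le_ciSup (hbdd S) f₀),
      ciSup_le fun f => (abs_le.mp (hdevB f S)).2⟩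
  have hupd : ∀ f S i z, e f S - e f (Function.update S i z) = (1 / (n : ℝ)) * (h f (S i) - h f z) :=
    fun f S i z => by
      simp only [he]
      rw [← mul_sub, ← Finset.sum_sub_distrib, Finset.sum_eq_single i]
      · simp
      · intro j _ hj; simp [Function.update_of_ne hj]
      · simp
  have hΦc : ∀ S i z, (⨆ f, dev f S) ≤ (⨆ f, dev f (Function.update S i z)) + 2 * M / n := by
    intro S i z
    refine ciSup_le fun f => ?_
    have h1 := le_ciSup (hbdd (Function.update S i z)) f
    have h2 := hupd f S i z
    have h3 := hupd f₀ S i z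
    have h4 : (1 / (n : ℝ)) * ((h f₀ (S i) - h f₀ z) - (h f (S i) - h f z)) ≤ 1 / n * (2 * M) := by
      refine mul_le_mul_of_nonneg_left ?_ (by positivity)
      have := hψM f₀ (S i); have := hψM f₀ z; have := hψM f (S i); have := hψM f z
      simp only [Set.mem_Icc, hh] at *
      linarith
    have h5 : 1 / (n : ℝ) * (2 * M) = 2 * M / n := by ring
    simp only [hdev] at h1 ⊢
    linarith
  obtain ⟨Ψ, hΨm, hΨB, hΦΨ, hmin, hΨc⟩ := exists_majorant_bounded_differences μ
    (fun S => ⨆ f, dev f S) (2 * M) (2 * M / n) hΦB hΦc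
  have he0 : ∫ S, e f₀ S ∂ν = R f₀ := by
    have hint : ∀ i, Integrable (fun S : Fin n → Z => h f₀ (S i)) ν := fun i =>
      integrable_of_abs_le ((hm f₀).comp (measurable_pi_apply i)) fun S => hhM f₀ _
    have hcomp : ∀ i, ∫ S, h f₀ (S i) ∂ν = R f₀ := fun i =>
      integral_comp_eval (μ := fun _ : Fin n => μ) (i := i) (hm f₀).aestronglyMeasurable
    simp only [he]
    rw [integral_const_mul, integral_finsetSum _ fun i _ => hint i]
    simp only [hcomp]
    simp
    field_simp
  have hmean : ∀ N : ℕ, 0 < N → ∫ S, Ψ S ∂ν ≤ 2 * K * rad + 4 * K / N := by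
    intro N hN
    obtain ⟨G, D, hGm, hGD, hG, hGle⟩ := exists_signed_majorant μ u hu ψ hψm K B hK hψ
      hψB hn hsup hN
    obtain ⟨C, hCm, hCD, hC, hCint⟩ := exists_majorant_deviation μ h hm M hhM G D hGm hGD hG
    have hCi : Integrable (fun S => 1 / (n : ℝ) * C S) ν :=
      (integrable_of_abs_le hCm hCD).const_mul _
    have hei0 : Integrable (fun S => R f₀ - e f₀ S) ν :=
      (integrable_const _).sub (integrable_of_abs_le (hem f₀) (B := M) fun S => by
        rw [abs_of_nonneg (hei f₀ S).1]; exact (hei f₀ S).2)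
    -- The symmetrization majorant, corrected by the centred reference term, competes with `Ψ`;
    -- minimality transfers its mean bound to `Ψ`.
    have h1 := hmin (fun S => 1 / (n : ℝ) * C S - (R f₀ - e f₀ S))
      ((hCm.const_mul _).sub (measurable_const.sub (hem f₀))) (hCi.sub hei0) fun S => by
        refine ciSup_le fun f => ?_
        have h2 := mul_le_mul_of_nonneg_left (hC f S) (by positivity : (0 : ℝ) ≤ 1 / n)
        have h3 : 1 / (n : ℝ) * ∑ i, ((∫ z, h f z ∂μ) - h f (S i)) = R f - e f S := by
          rw [Finset.sum_sub_distrib, mul_sub]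
          simp only [Finset.sum_const, Finset.card_univ, Fintype.card_fin, nsmul_eq_mul, he, hR]
          field_simp
        simp only [hdev]
        linarith
    have h4 : ∫ S, (R f₀ - e f₀ S) ∂ν = 0 := by
      rw [integral_sub (integrable_const _) (integrable_of_abs_le (hem f₀) (B := M) fun S => by
        rw [abs_of_nonneg (hei f₀ S).1]; exact (hei f₀ S).2), he0]
      simp
    rw [integral_sub hCi hei0, h4, integral_const_mul, hCint] at h1
    have h5 := mul_le_mul_of_nonneg_left hGle (by positivity : (0 : ℝ) ≤ 2 / n)
    have h6 : 2 / (n : ℝ) * (n * K * rad + 2 * n * K / N) = 2 * K * rad + 4 * K / N := by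
      field_simp; ring
    rw [← hrad, h6] at h5
    refine h1.trans ((le_of_eq ?_).trans h5)
    ring
  -- `Ψ` does not depend on the grid, so `N` can tend to infinity.
  have hmean' : ∫ S, Ψ S ∂ν ≤ 2 * K * rad := by
    refine le_of_forall_pos_le_add fun ε hε => ?_
    obtain ⟨N, hN⟩ := exists_nat_gt (4 * K / ε)
    have hN0 : (0 : ℝ) < N := lt_of_le_of_lt (by positivity) hN
    refine (hmean N (by exact_mod_cast hN0)).trans ?_
    gcongr
    rw [div_le_iff₀ hN0]
    rw [div_lt_iff₀ hε] at hN
    linarith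
  set t := 2 * M * √(Real.log (2 / δ) / (2 * (n : ℝ))) with ht
  have hlog : 0 < Real.log (2 / δ) := Real.log_pos (by rw [lt_div_iff₀ hδ]; linarith)
  have hconc := measure_add_le_of_bounded_differences μ hn Ψ hΨm (2 * M) (2 * M / n)
    (by positivity) hΨB hΨc t (by positivity)
  -- The McDiarmid exponent is exactly `log (2 / δ)`, so the failure probability is at most `δ / 2`,
  -- within the allowed `δ`.
  have hexp : Real.exp (-(2 * t ^ 2 / (n * (2 * M / n) ^ 2))) = δ / 2 := by
    have : 2 * t ^ 2 / (n * (2 * M / n) ^ 2) = Real.log (2 / δ) := by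
      rw [ht, mul_pow, Real.sq_sqrt (by positivity)]
      field_simp
    rw [this, Real.exp_neg, Real.exp_log (by positivity), inv_div]
  rw [hexp] at hconc
  have hEm : MeasurableSet {S | (∫ S, Ψ S ∂ν) + t ≤ Ψ S} := measurableSet_le measurable_const hΨm
  refine ⟨{S | (∫ S, Ψ S ∂ν) + t ≤ Ψ S}ᶜ, hEm.compl, ?_, fun S hS f => ?_⟩
  · rw [ENNReal.ofReal_le_iff_le_toReal (measure_ne_top _ _)]
    change _ ≤ ν.real _
    rw [probReal_compl_eq_one_sub hEm]
    linarith
  · have h1 : Ψ S < (∫ S, Ψ S ∂ν) + t := not_le.mp hS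
    have h2 : dev f S ≤ Ψ S := (le_ciSup (hbdd S) f).trans (hΦΨ S)
    change dev f S ≤ _
    linarith

/-! ### The transition function and the law of the sample -/

/-- Two distinct `π j` cannot all be 0 or all be 1. This strictness makes `alpha` positive. -/
theorem sum_weights_mem_Ioo {m : ℕ} (π ρ : Fin m → ℝ) (hπ : ∀ j, π j ∈ Set.Icc (0 : ℝ) 1)
    (hπne : ∃ j j', j ≠ j' ∧ π j ≠ π j') (hρ : ∀ j, 0 < ρ j) (hρsum : ∑ j, ρ j = 1) :
    ∑ j, ρ j * π j ∈ Set.Ioo (0 : ℝ) 1 := by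
  obtain ⟨j, j', -, hne⟩ := hπne
  constructor
  · have : ∃ i, 0 < π i := by
      by_contra! hcon
      exact hne ((le_antisymm (hcon j) (hπ j).1).trans (le_antisymm (hcon j') (hπ j').1).symm)
    obtain ⟨i, hi⟩ := this
    exact Finset.sum_pos' (fun k _ => mul_nonneg (hρ k).le (hπ k).1)
      ⟨i, Finset.mem_univ _, mul_pos (hρ i) hi⟩
  · have : ∃ i, π i < 1 := by
      by_contra! hcon
      exact hne ((le_antisymm (hπ j).2 (hcon j)).trans (le_antisymm (hπ j').2 (hcon j')).symm)
    obtain ⟨i, hi⟩ := this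
    rw [← hρsum]
    exact Finset.sum_lt_sum (fun k _ => mul_le_of_le_one_right (hρ k).le (hπ k).2)
      ⟨i, Finset.mem_univ _, mul_lt_of_lt_one_right (hρ i) hi⟩

/-- In terms of p = ∑ ρ j π j, the closed forms here and below show that `alpha` is the minimum of
`c + d` and `d`, the values of the denominator `c t + d` at 1 and 0. -/
theorem coefC_eq {m : ℕ} (π ρ : Fin m → ℝ) (πD : ℝ) (hρsum : ∑ j, ρ j = 1) :
    coefC π ρ πD = ∑ j, ρ j * π j - πD := by
  simp only [coefC, mul_sub, Finset.sum_sub_distrib, ← Finset.sum_mul, hρsum, one_mul]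

theorem coefD_eq {m : ℕ} (π ρ : Fin m → ℝ) (πD : ℝ) (hρsum : ∑ j, ρ j = 1) :
    coefD π ρ πD = πD * (1 - ∑ j, ρ j * π j) := by
  have : ∀ j, ρ j * πD * (1 - π j) = πD * (ρ j - ρ j * π j) := fun j => by ring
  simp only [coefD, this, ← Finset.mul_sum, Finset.sum_sub_distrib, hρsum]

theorem alpha_eq {m : ℕ} (π ρ : Fin m → ℝ) (πD : ℝ) (hρsum : ∑ j, ρ j = 1) :
    alpha π ρ πD = min ((∑ j, ρ j * π j) * (1 - πD)) (πD * (1 - ∑ j, ρ j * π j)) := by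
  rw [← coefD_eq π ρ πD hρsum, Finset.sum_mul]
  rfl

/-- The factor √m would do; the cruder `m` is the one in the final bound. -/
theorem norm_le_of_forall_abs_le {m : ℕ} (v : EuclideanSpace ℝ (Fin m)) (r : ℝ) (hr : 0 ≤ r)
    (hv : ∀ j, |v j| ≤ r) : ‖v‖ ≤ m * r := by
  rw [EuclideanSpace.norm_eq, Real.sqrt_le_iff]
  refine ⟨by positivity, ?_⟩
  calc ∑ j, ‖v j‖ ^ 2 ≤ ∑ _j : Fin m, r ^ 2 := Finset.sum_le_sum fun j _ => by
        rw [Real.norm_eq_abs]; exact pow_le_pow_left₀ (abs_nonneg _) (hv j) 2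
    _ = m * r ^ 2 := by simp
    _ ≤ (m : ℝ) ^ 2 * r ^ 2 := by
        gcongr
        exact_mod_cast Nat.le_self_pow two_ne_zero m
    _ = _ := by ring

/-- Each component is a linear fractional map, so its increment is (a d - b c)(s - t) / ((c s + d)(c
t + d)). The determinant equals ρ j π_D (1 - π_D)(π j - p) with p = ∑ ρ j π j, of modulus at most 1.
The denominator is affine and at least `alpha` at both endpoints, hence on all of [0, 1]. -/
theorem dist_transition_le {m : ℕ} (π ρ : Fin m → ℝ) (πD : ℝ)
    (hπ : ∀ j, π j ∈ Set.Icc (0 : ℝ) 1) (hπne : ∃ j j', j ≠ j' ∧ π j ≠ π j') (hρ : ∀ j, 0 < ρ j)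
    (hρsum : ∑ j, ρ j = 1) (hπD : πD ∈ Set.Ioo (0 : ℝ) 1) {s t : ℝ}
    (hs : s ∈ Set.Icc (0 : ℝ) 1) (ht : t ∈ Set.Icc (0 : ℝ) 1) :
    dist (transition π ρ πD s) (transition π ρ πD t) ≤ m / alpha π ρ πD ^ 2 * |s - t| := by
  have hp := sum_weights_mem_Ioo π ρ hπ hπne hρ hρsum
  have hα := alpha_eq π ρ πD hρsum
  have hc := coefC_eq π ρ πD hρsum
  have hd := coefD_eq π ρ πD hρsum
  set p := ∑ j, ρ j * π j with hpdef
  set α := alpha π ρ πD with hαdef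
  set c := coefC π ρ πD
  set d := coefD π ρ πD
  obtain ⟨hp0, hp1⟩ := hp
  obtain ⟨hD0, hD1⟩ := hπD
  have hα0 : 0 < α := by
    rw [hα]
    exact lt_min (mul_pos hp0 (by linarith)) (mul_pos hD0 (by linarith))
  have hden : ∀ r ∈ Set.Icc (0 : ℝ) 1, α ≤ c * r + d := fun r hr => by
    have h1 : α ≤ c + d := by
      rw [hα, hc, hd]
      exact (min_le_left _ _).trans (le_of_eq (by ring))
    have h2 : α ≤ d := by rw [hα, hd]; exact min_le_right _ _
    nlinarith [mul_le_mul_of_nonneg_left h1 hr.1,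
      mul_le_mul_of_nonneg_left h2 (sub_nonneg.mpr hr.2)]
  rw [dist_eq_norm]
  refine (norm_le_of_forall_abs_le _ (|s - t| / α ^ 2) (by positivity) fun j => ?_).trans
    (le_of_eq (by ring))
  have hds := hden s hs
  have hdt := hden t ht
  have hρ1 : ρ j ≤ 1 := by
    rw [← hρsum]
    exact Finset.single_le_sum (fun k _ => (hρ k).le) (Finset.mem_univ j)
  have hdet : |coefA π ρ πD j * d - coefB π ρ πD j * c| ≤ 1 := by
    have : coefA π ρ πD j * d - coefB π ρ πD j * c = ρ j * (πD * ((1 - πD) * (π j - p))) := by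
      rw [hc, hd, coefA, coefB]; ring
    rw [this, abs_mul, abs_mul, abs_mul, abs_of_pos (hρ j), abs_of_pos hD0,
      abs_of_pos (sub_pos.mpr hD1)]
    have h1 : |π j - p| ≤ 1 := abs_le.mpr ⟨by linarith [(hπ j).1], by linarith [(hπ j).2]⟩
    exact mul_le_one₀ hρ1 (mul_nonneg hD0.le (mul_nonneg (by linarith) (abs_nonneg _)))
      (mul_le_one₀ hD1.le (mul_nonneg (by linarith) (abs_nonneg _))
        (mul_le_one₀ (by linarith) (abs_nonneg _) h1))
  have hdiff : (transition π ρ πD s - transition π ρ πD t) j =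
      (coefA π ρ πD j * d - coefB π ρ πD j * c) * (s - t) / ((c * s + d) * (c * t + d)) := by
    have h1 : c * s + d ≠ 0 := (hα0.trans_le hds).ne'
    have h2 : c * t + d ≠ 0 := (hα0.trans_le hdt).ne'
    change (coefA π ρ πD j * s + coefB π ρ πD j) / (c * s + d) -
      (coefA π ρ πD j * t + coefB π ρ πD j) / (c * t + d) = _
    rw [div_sub_div _ _ h1 h2]
    congr 1
    ring
  rw [hdiff, abs_div, abs_mul, abs_of_pos (mul_pos (hα0.trans_le hds) (hα0.trans_le hdt))]
  refine div_le_div₀ (abs_nonneg _) (mul_le_of_le_one_left (abs_nonneg _) hdet) (by positivity) ?_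
  rw [sq]
  exact mul_le_mul hds hdt hα0.le (hα0.le.trans hds)

theorem isProbabilityMeasure_surrogateLaw {X : Type*} [MeasurableSpace X] (Pp Pn : Measure X)
    [IsProbabilityMeasure Pp] [IsProbabilityMeasure Pn] {m : ℕ} (π ρ : Fin m → ℝ)
    (hπ : ∀ j, π j ∈ Set.Icc (0 : ℝ) 1) (hρ : ∀ j, 0 < ρ j) (hρsum : ∑ j, ρ j = 1) :
    IsProbabilityMeasure (surrogateLaw Pp Pn π ρ) := by
  constructor
  have h1 : ∀ j, (setLaw Pp Pn π j).map (fun x => (x, j)) Set.univ = 1 := fun j => by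
    rw [Measure.map_apply (by fun_prop) MeasurableSet.univ, Set.preimage_univ]
    simp only [setLaw, Measure.add_apply, Measure.smul_apply, measure_univ, smul_eq_mul, mul_one]
    rw [← ENNReal.ofReal_add (hπ j).1 (by linarith [(hπ j).2])]
    simp
  simp only [surrogateLaw, Measure.finsetSum_apply, Measure.smul_apply, h1, smul_eq_mul, mul_one]
  rw [← ENNReal.ofReal_sum_of_nonneg fun j _ => (hρ j).le, hρsum, ENNReal.ofReal_one]

theorem le_signedSup {X : Type*} {n : ℕ} (F : Set (X → ℝ))
    (hF01 : ∀ f ∈ F, ∀ x, f x ∈ Set.Icc (0 : ℝ) 1) (σ : Fin n → ℤˣ) (x : Fin n → X) {f : X → ℝ}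
    (hf : f ∈ F) : (1 / (n : ℝ)) * ∑ i, ((σ i : ℤ) : ℝ) * f (x i) ≤ signedSup F σ x := by
  refine le_ciSup (f := fun f : F => (1 / (n : ℝ)) * ∑ i, ((σ i : ℤ) : ℝ) * (f : X → ℝ) (x i))
    ⟨1 / (n : ℝ) * (n * 1), ?_⟩ ⟨f, hf⟩
  rintro _ ⟨g, rfl⟩
  refine mul_le_mul_of_nonneg_left ((le_abs_self _).trans
    (abs_sum_signs_mul_le σ (fun i => g.1 (x i)) 1 fun i => ?_)) (by positivity)
  have := hF01 g g.2 (x i)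
  exact abs_le.mpr ⟨by linarith [this.1], this.2⟩

/-- For one fixed f the contributions of σ and -σ cancel, and the supremum dominates that f.
Nonnegativity is what permits enlarging the constant in front of the complexity. -/
theorem rademacherComplexity_nonneg {X : Type*} [MeasurableSpace X] (μ : Measure X) (n : ℕ)
    (F : Set (X → ℝ)) (hF01 : ∀ f ∈ F, ∀ x, f x ∈ Set.Icc (0 : ℝ) 1) (hF : F.Nonempty) :
    0 ≤ rademacherComplexity μ n F := by
  obtain ⟨f, hf⟩ := hF
  refine integral_nonneg fun x => mul_nonneg (by positivity) ?_
  refine le_trans (le_of_eq ?_) (Finset.sum_le_sum fun σ _ => le_signedSup F hF01 σ x hf)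
  have h := Equiv.sum_comp (Equiv.neg (Fin n → ℤˣ)) fun σ =>
    (1 / (n : ℝ)) * ∑ i, ((σ i : ℤ) : ℝ) * f (x i)
  simp only [Equiv.neg_apply, Pi.neg_apply, Units.val_neg, Int.cast_neg, neg_mul,
    Finset.sum_neg_distrib, mul_neg] at h
  linarith

end UmSSC

/-! ### The estimation error bound -/

theorem theorem3 {X : Type*} [MeasurableSpace X]
    (Pp Pn : Measure X) [IsProbabilityMeasure Pp] [IsProbabilityMeasure Pn]
    {m : ℕ} (π ρ : Fin m → ℝ) (πD : ℝ)
    (hπ : ∀ j, π j ∈ Set.Icc (0 : ℝ) 1) (hπne : ∃ j j', j ≠ j' ∧ π j ≠ π j')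
    (hρ : ∀ j, 0 < ρ j) (hρsum : ∑ j, ρ j = 1)
    (hπD : πD ∈ Set.Ioo (0 : ℝ) 1)
    (F : Set (X → ℝ)) (hFmeas : ∀ f ∈ F, Measurable f)
    (hF01 : ∀ f ∈ F, ∀ x, f x ∈ Set.Icc (0 : ℝ) 1)
    (loss : EuclideanSpace ℝ (Fin m) → Fin m → ℝ) (M : ℝ) (L : ℝ≥0)
    (hnonneg : ∀ f ∈ F, ∀ x y, 0 ≤ loss (UmSSC.transition π ρ πD (f x)) y)
    (hbound : ∀ f ∈ F, ∀ x y, loss (UmSSC.transition π ρ πD (f x)) y ≤ M)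
    (hlip : ∀ y, LipschitzOnWith L (fun u => loss u y)
      {u | ∃ f ∈ F, ∃ x, u = UmSSC.transition π ρ πD (f x)})
    (n : ℕ) (hn : 0 < n)
    (hsup : ∀ σ : Fin n → ℤˣ, AEMeasurable (fun x : Fin n → X => UmSSC.signedSup F σ x)
      (Measure.pi fun _ : Fin n => (UmSSC.surrogateLaw Pp Pn π ρ).map Prod.fst))
    (fstar : X → ℝ) (hfstar : fstar ∈ F)
    (hfstar_min : ∀ f ∈ F, UmSSC.surrRisk Pp Pn π ρ πD loss fstar
      ≤ UmSSC.surrRisk Pp Pn π ρ πD loss f)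
    (δ : ℝ) (hδ : 0 < δ) :
    ∃ E : Set (Fin n → X × Fin m), MeasurableSet E ∧
      ENNReal.ofReal (1 - δ) ≤ (Measure.pi fun _ : Fin n => UmSSC.surrogateLaw Pp Pn π ρ) E ∧
      ∀ S ∈ E, ∀ fhat ∈ F,
        (∀ f ∈ F, UmSSC.empRisk π ρ πD loss S fhat ≤ UmSSC.empRisk π ρ πD loss S f) →
        UmSSC.surrRisk Pp Pn π ρ πD loss fhat - UmSSC.surrRisk Pp Pn π ρ πD loss fstar ≤
          8 * √2 * (m : ℝ) * (L : ℝ) / UmSSC.alpha π ρ πD ^ 2 *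
              UmSSC.rademacherComplexity ((UmSSC.surrogateLaw Pp Pn π ρ).map Prod.fst) n F +
            2 * M * √(Real.log (2 / δ) / (2 * (n : ℝ))) := by
  have := UmSSC.isProbabilityMeasure_surrogateLaw Pp Pn π ρ hπ hρ hρsum
  set μ := UmSSC.surrogateLaw Pp Pn π ρ with hμ
  have hrad0 := UmSSC.rademacherComplexity_nonneg (μ.map Prod.fst) n F hF01 ⟨fstar, hfstar⟩
  set rad := UmSSC.rademacherComplexity (μ.map Prod.fst) n F with hrad
  have ⟨j₀, _⟩ := hπne
  obtain ⟨x₀⟩ : Nonempty X := nonempty_of_isProbabilityMeasure Pp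
  have hM0 : 0 ≤ M := (hnonneg fstar hfstar x₀ j₀).trans (hbound fstar hfstar x₀ j₀)
  rcases le_or_gt 1 δ with hδ1 | hδ1
  · exact ⟨∅, MeasurableSet.empty, by simp [ENNReal.ofReal_of_nonpos (sub_nonpos.mpr hδ1)],
      fun S hS => absurd hS (Set.notMem_empty S)⟩
  -- The concentration step needs a positive difference bound; when `M = 0`, all risks over the
  -- class vanish.
  rcases hM0.eq_or_lt with hM | hM
  · have hz : ∀ f ∈ F, UmSSC.surrRisk Pp Pn π ρ πD loss f = 0 := fun f hf => by
      have : ∀ z : X × Fin m, loss (UmSSC.transition π ρ πD (f z.1)) z.2 = 0 := fun z =>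
        le_antisymm ((hbound f hf _ _).trans hM.ge) (hnonneg f hf _ _)
      simp [UmSSC.surrRisk, this]
    refine ⟨Set.univ, MeasurableSet.univ, ?_, fun S _ fhat hfhat _ => ?_⟩
    · rw [measure_univ]
      exact ENNReal.ofReal_le_one.mpr (by linarith)
    · rw [hz fhat hfhat, hz fstar hfstar, sub_zero]
      positivity
  set α := UmSSC.alpha π ρ πD with hα
  set K : ℝ := m * L / α ^ 2 with hKdef
  have hK : 0 ≤ K := by positivity
  have hKlip : ∀ y, LipschitzOnWith K.toNNReal
      (fun t => loss (UmSSC.transition π ρ πD t) y) {t | ∃ f ∈ F, ∃ x, t = f x} := fun y => by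
    refine LipschitzOnWith.of_dist_le_mul ?_
    rintro s ⟨f, hf, x, rfl⟩ t ⟨g, hg, x', rfl⟩
    rw [Real.coe_toNNReal K hK]
    refine ((hlip y).dist_le_mul _ ⟨f, hf, x, rfl⟩ _ ⟨g, hg, x', rfl⟩).trans ?_
    refine (mul_le_mul_of_nonneg_left (UmSSC.dist_transition_le π ρ πD hπ hπne hρ hρsum hπD
      (hF01 f hf x) (hF01 g hg x')) L.coe_nonneg).trans (le_of_eq ?_)
    rw [hKdef, Real.dist_eq]
    ring
  -- The loss is controlled only at values attained by the class, whereas the discretization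
  -- evaluates it at grid points, hence the Lipschitz extension to ℝ. The extension may leave `[0,
  -- M]`, but on `[0, 1]` every point is within 1 of an attained value, which gives the bound `M +
  -- K`.
  choose φ hφlip hφ using fun y => (hKlip y).extend_real
  have hφeq : ∀ f ∈ F, ∀ x y, φ y (f x) = loss (UmSSC.transition π ρ πD (f x)) y :=
    fun f hf x y => (hφ y ⟨f, hf, x, rfl⟩).symm
  have hφdist : ∀ y s t, |φ y s - φ y t| ≤ K * |s - t| := fun y s t => by
    have h := (hφlip y).dist_le_mul s t
    rwa [Real.coe_toNNReal K hK, Real.dist_eq, Real.dist_eq] at h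
  have hφB : ∀ y, ∀ t ∈ Set.Icc (0 : ℝ) 1, |φ y t| ≤ M + K := fun y t ht => by
    have h1 := hφdist y t (fstar x₀)
    have h2 : |t - fstar x₀| ≤ 1 := by
      have := hF01 fstar hfstar x₀
      exact abs_le.mpr ⟨by linarith [ht.1, this.2], by linarith [ht.2, this.1]⟩
    have h3 : |φ y (fstar x₀)| ≤ M := by
      rw [hφeq fstar hfstar, abs_of_nonneg (hnonneg fstar hfstar _ _)]
      exact hbound fstar hfstar _ _
    have h4 := abs_add_le (φ y (fstar x₀)) (φ y t - φ y (fstar x₀))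
    rw [add_sub_cancel] at h4
    nlinarith [mul_le_mul_of_nonneg_left h2 hK]
  have hproj : MeasurePreserving (fun (S : Fin n → X × Fin m) i => (S i).1)
      (Measure.pi fun _ => μ) (Measure.pi fun _ => μ.map Prod.fst) :=
    have : IsProbabilityMeasure (μ.map Prod.fst) :=
      Measure.isProbabilityMeasure_map measurable_fst.aemeasurable
    measurePreserving_pi _ _ fun _ => measurable_fst.measurePreserving μ
  have hradeq : rad = ∫ S : Fin n → X × Fin m, 1 / 2 ^ n * ∑ σ : Fin n → ℤˣ,
      (⨆ f : F, (1 / (n : ℝ)) * ∑ i, ((σ i : ℤ) : ℝ) * (f : X → ℝ) (S i).1)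
        ∂(Measure.pi fun _ => μ) := by
    rw [hrad, UmSSC.rademacherComplexity, ← hproj.map_eq,
      integral_map hproj.measurable.aemeasurable]
    · rfl
    · rw [hproj.map_eq]
      exact ((Finset.aemeasurable_fun_sum _ fun σ _ => hsup σ).const_mul _).aestronglyMeasurable
  obtain ⟨E, hEm, hE, hdev⟩ := UmSSC.exists_event_deviation_le μ (ι := F) ⟨fstar, hfstar⟩
    (fun f z => (f : X → ℝ) z.1) (fun f z => hF01 f f.2 z.1) (fun z t => φ z.2 t)
    (fun t => (measurable_from_top (f := fun y => φ y t)).comp measurable_snd)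
    K (M + K) M hK (fun z => hφdist z.2) (fun z => hφB z.2)
    (fun f => measurable_from_prod_countable_left fun y =>
      (hφlip y).continuous.measurable.comp (hFmeas f f.2)) hM
    (fun f z => by
      rw [hφeq f f.2]; exact ⟨hnonneg f f.2 _ _, hbound f f.2 _ _⟩) hn
    (fun σ => (hsup σ).comp_quasiMeasurePreserving hproj.quasiMeasurePreserving) δ hδ hδ1
  rw [← hradeq] at hdev
  refine ⟨E, hEm, hE, fun S hS fhat hfhat hmin => ?_⟩
  have h1 := hdev S hS ⟨fhat, hfhat⟩
  have h2 := hmin fstar hfstar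
  simp only [hφeq fhat hfhat, hφeq fstar hfstar] at h1
  -- Scalar contraction yields the constant 2, which is smaller than the stated `8 √2`.
  have h3 : 2 * K * rad ≤ 8 * √2 * m * L / α ^ 2 * rad := by
    refine mul_le_mul_of_nonneg_right ?_ hrad0
    have h4 : 8 * √2 * m * L / α ^ 2 = 8 * √2 * K := by rw [hKdef]; ring
    have h5 : (1 : ℝ) ≤ √2 := Real.one_le_sqrt.mpr one_le_two
    rw [h4]
    nlinarith
  simp only [UmSSC.empRisk] at h2
  simp only [UmSSC.surrRisk]
  linarith
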